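/- Let $G$ be a finite network, directed or undirected, in which each link $e$ has capacity $C(e)\ge 0$. Requests arrive one after another at times $a_1\le a_2\le\cdots$ (finitely or infinitely many); request $i$ is a job $(s_i,d_i,f_i)$, asking to send a file of size $f_i>0$ from $s_i$ to $d_i\neq s_i$. For a set $L$ of jobs and $T\ge 0$, say that $L$ is \emph{feasible in time $T$} in a network if there is a multicommodity flow respecting the link capacities (on an undirected link the two directions share the capacity) whose flow for each job $(s,d,f)\in L$ goes from $s$ to $d$ and has rate $f/T$; let $\mathrm{maxflow}(L)$ be the minimum such $T$. The on-line algorithm $\mathtt{BatchLim}$ maintains a chronological list of disjoint time slots, initially empty, each with a set of jobs. When a request $l$ arrives at time $t$, it is assigned to the first slot $[u,v]$ of the list with $u\ge t$ for which the jobs already in the slot together with $l$ are feasible in time $v-u$. If there is no such slot, let $t_n$ be the end of the last slot, or $t_n=t$ if there is no slot or all slots have ended by time $t$; the new slot $[t_n,t_{n+1}]$ with $t_{n+1}=t_n+\max(t_n-t,\mathrm{maxflow}(\{l\}))$ is appended to the list, and $l$ is assigned to it. The completion time of a request is the end of the slot to which it is assigned, and its waiting time is its completion time minus its arrival time. An off-line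 schedule for a set of requests sends each request $i$ over the links at (measurable) time-dependent rates which at each time form a multicommodity flow respecting the link capacities, vanish before the arrival $a_i$ and after the completion time $c_i\ge a_i$, and transmit in total $f_i$ from $s_i$ to $d_i$; the waiting time of request $i$ is $c_i-a_i$. The optimal maximum waiting time of a set of requests is the infimum, over all off-line schedules for it, of the maximum (supremum) waiting time ($\infty$ if there is no schedule with bounded waiting times). \textbf{Theorem.} For every $\varepsilon>0$ and every time $t^*$, when $\mathtt{BatchLim}$ is run in the augmented network, in which every link $e$ has capacity $(1+\varepsilon)C(e)$, the maximum waiting time of the requests arriving up to time $t^*$ is at most $4/\varepsilon$ times the optimal maximum waiting time of these requests in the original network $G$. -/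

import Mathlib

open MeasureTheory
open scoped ENNReal

noncomputable section

/-- A finite network with vertex type `V` and link type `E`. A link `e` joins `src e` and `dst e`
and has capacity `cap e`. A one-way link carries data only from `src e` to `dst e`; any other link
carries data in both directions, which share its capacity. A directed graph has only one-way links,
an undirected graph has none. -/
structure Network (V E : Type*) where
  src : E → V
  dst : E → V
  oneWay : E → Prop
  cap : E → ℝ
  cap_nonneg : ∀ e, 0 ≤ cap e

/-- A job `(s, d, f)`. -/
structure Job (V : Type*) where
  source : V
  dest : V
  size : ℝ
  source_ne_dest : source ≠ dest
  size_pos : 0 < size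

/-- A connection request: a job together with its arrival time. -/
structure Request (V : Type*) extends Job V where
  arrival : ℝ

namespace Network

variable {V E : Type*}

/-- The network in which each capacity is multiplied by `1 + ε`. -/
def augment (G : Network V E) (ε : ℝ) (hε : 0 < ε) : Network V E where
  src := G.src
  dst := G.dst
  oneWay := G.oneWay
  cap e := (1 + ε) * G.cap e
  cap_nonneg e := mul_nonneg (by linarith) (G.cap_nonneg e)

/-- The tail of link `e`, traversed forwards (`true`) or backwards (`false`). -/
def tail (G : Network V E) (e : E) (b : Bool) : V := if b then G.src e else G.dst e

/-- The head of link `e`, traversed forwards (`true`) or backwards (`false`). -/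
def head (G : Network V E) (e : E) (b : Bool) : V := if b then G.dst e else G.src e

variable [Fintype E]

open Classical in
/-- Total rate out of `u` minus total rate into `u`, where `x e b` is the rate on link `e` in
direction `b`. -/
def netOut (G : Network V E) (x : E → Bool → ℝ) (u : V) : ℝ :=
  (∑ e, ∑ b, if G.tail e b = u then x e b else 0) -
    ∑ e, ∑ b, if G.head e b = u then x e b else 0

/-- `x` is a flow from `s` to `d` (its value is `G.netOut x s`), capacities not considered. -/
structure IsFlow (G : Network V E) (s d : V) (x : E → Bool → ℝ) : Prop where
  nonneg : ∀ e b, 0 ≤ x e b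
  direction : ∀ e, G.oneWay e → x e false = 0
  conservation : ∀ u, u ≠ s → u ≠ d → G.netOut x u = 0
  value_nonneg : 0 ≤ G.netOut x s

/-- `x i`, for `i ∈ L`, are concurrent flows for the jobs `job i` (a multicommodity flow) that
together respect the link capacities. -/
structure IsMultiflow {ι : Type*} (G : Network V E) (job : ι → Job V) (L : Finset ι)
    (x : ι → E → Bool → ℝ) : Prop where
  flow : ∀ i ∈ L, G.IsFlow (job i).source (job i).dest (x i)
  capacity : ∀ e, ∑ i ∈ L, (x i e true + x i e false) ≤ G.cap e

/-- `multicomm(G, L, T)`: the jobs in `L` can be transmitted concurrently, at constant rates,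
during a time of length `T`. -/
def Multicomm {ι : Type*} (G : Network V E) (job : ι → Job V) (L : Finset ι) (T : ℝ) : Prop :=
  0 ≤ T ∧ ∃ x : ι → E → Bool → ℝ, G.IsMultiflow job L x ∧
    ∀ i ∈ L, G.netOut (x i) (job i).source * T = (job i).size

/-- `maxflow(G, L)`: the minimum `T` for which `multicomm(G, L, T)` is true. -/
def maxflow {ι : Type*} (G : Network V E) (job : ι → Job V) (L : Finset ι) : ℝ :=
  sInf {T : ℝ | G.Multicomm job L T}

end Network

/-- The requests (numbered `0, 1, …`, there being `N ≤ ∞` of them) that arrive up to time `t`. -/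
def arrivedUpTo {V : Type*} (N : ℕ∞) (req : ℕ → Request V) (t : ℝ) : Set ℕ :=
  {i | (i : ℕ∞) < N ∧ (req i).arrival ≤ t}

/-- The maximum (supremum) over the requests in `S` of the time from arrival to completion. -/
def maxWait {V : Type*} (req : ℕ → Request V) (S : Set ℕ) (completion : ℕ → ℝ) : ℝ≥0∞ :=
  ⨆ i ∈ S, ENNReal.ofReal (completion i - (req i).arrival)

/-- An off-line schedule in the network `G` that serves all the requests in `S`: at each time `τ`
request `i` is sent at rate `rate i τ e b` over link `e` in direction `b`. The rates may vary with
time, form a multicommodity flow at each time, vanish before the arrival and after the completion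
of the request, and transmit its whole file in between. -/
structure Schedule {V E : Type*} [Fintype E] (G : Network V E) (req : ℕ → Request V)
    (S : Set ℕ) where
  completion : ℕ → ℝ
  rate : ℕ → ℝ → E → Bool → ℝ
  arrival_le_completion : ∀ i ∈ S, (req i).arrival ≤ completion i
  measurable_rate : ∀ i ∈ S, ∀ e b, Measurable fun τ => rate i τ e b
  multiflow : ∀ L : Finset ℕ, (L : Set ℕ) ⊆ S → ∀ τ,
    G.IsMultiflow (fun i => (req i).toJob) L (fun i => rate i τ)
  rate_eq_zero : ∀ i ∈ S, ∀ τ, τ ∉ Set.Icc (req i).arrival (completion i) →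
    ∀ e b, rate i τ e b = 0
  transmitted : ∀ i ∈ S,
    ∫ τ in (req i).arrival..completion i, G.netOut (rate i τ) (req i).source = (req i).size

/-- The optimal (least possible) maximum waiting time over all off-line schedules in `G` for the
requests in `S`; it is `∞` if they cannot all be served within bounded time. -/
def optMaxWait {V E : Type*} [Fintype E] (G : Network V E) (req : ℕ → Request V)
    (S : Set ℕ) : ℝ≥0∞ :=
  ⨅ σ : Schedule G req S, maxWait req S σ.completion

namespace BatchLim

/-- A slot `[start, finish]` with the (numbers of the) requests assigned to it. -/
structure Slot where
  start : ℝ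
  finish : ℝ
  jobs : Finset ℕ

/-- Assign request `i` to the first slot of the list that satisfies `P`; return the new list and
the end of that slot, or `none` if there is no such slot. -/
def tryAssign (P : Slot → Prop) [DecidablePred P] (i : ℕ) :
    List Slot → Option (List Slot × ℝ)
  | [] => none
  | σ :: rest =>
    if P σ then some ({σ with jobs := insert i σ.jobs} :: rest, σ.finish)
    else (tryAssign P i rest).map fun r => (σ :: r.1, r.2)

/-- The time from which a new slot can be appended at time `t`: the end of the last slot, or `t` if
there is none or all slots have ended. -/
def nextStart (t : ℝ) (slots : List Slot) : ℝ :=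
  match slots.getLast? with
  | none => t
  | some σ => max t σ.finish

variable {V E : Type*} [Fintype E]

/-- Request `i` fits into the slot `σ`: the slot has not begun before the arrival of the request,
and the multicommodity flow problem for its jobs and the new one is feasible. -/
def Fits (G : Network V E) (req : ℕ → Request V) (i : ℕ) (σ : Slot) : Prop :=
  (req i).arrival ≤ σ.start ∧
    G.Multicomm (fun k => (req k).toJob) (insert i σ.jobs) (σ.finish - σ.start)

open Classical in
/-- How request `i` is handled, given the current chronological list of slots: the new list of
slots, and the completion time that is returned (the end of the slot assigned to the request). -/
def step (G : Network V E) (req : ℕ → Request V) (i : ℕ) (slots : List Slot) :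
    List Slot × ℝ :=
  match tryAssign (Fits G req i) i slots with
  | some r => r
  | none =>
    let t := (req i).arrival
    let start := nextStart t slots
    let M := G.maxflow (fun k => (req k).toJob) {i}
    let finish := if M > start - t then start + M else start + (start - t)
    (slots ++ [⟨start, finish, {i}⟩], finish)

/-- The list of slots after the requests `0, …, n - 1` have been handled. -/
def slots (G : Network V E) (req : ℕ → Request V) : ℕ → List Slot
  | 0 => []
  | n + 1 => (step G req n (slots G req n)).1

/-- The completion time that `BatchLim` assigns to request `i`. -/
def completion (G : Network V E) (req : ℕ → Request V) (i : ℕ) : ℝ :=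
  (step G req i (slots G req i)).2

end BatchLim

end

/-! Let `W` bound the waiting times of an off-line schedule. Averaging that schedule over a time
window of length at most `(1 + ε) * T` turns it into constant rates for time `T` in the augmented
network (`Schedule.multicomm_augment`). Take a slot of length `ℓ`, created by request `j`, which has
not begun when request `n` fails to fit. The schedule serves the slot's jobs and `n` between `a_j`
and `a_n + W`, a window of length at most `ℓ + W`, since the slot starts at most `ℓ` after `a_j`. If
`ℓ > W / ε`, this is below `(1 + ε) * ℓ` and `n` would fit; hence `ℓ ≤ W / ε`
(`length_le_of_not_fits`), and the slot ends at most `2 * ℓ` after `a_n`. So a new slot is delayed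
by at most `2 * W / ε`, and its length obeys the same bound. Delay plus length gives `4 * W / ε`. -/

section Averaging

/-! ### Time averages of off-line schedules. -/

variable {V E : Type*} [Fintype E]

/-- `netOut` commutes with integration in time. -/
theorem Network.netOut_integral (G : Network V E) (r : ℝ → E → Bool → ℝ) (s : Set ℝ)
    (h : ∀ e b, IntegrableOn (fun τ => r τ e b) s) (u : V) :
    G.netOut (fun e b => ∫ τ in s, r τ e b) u = ∫ τ in s, G.netOut (r τ) u := by
  classical
  have hite : ∀ (p : Prop) [Decidable p] (e : E) (b : Bool),
      IntegrableOn (fun τ => if p then r τ e b else 0) s := by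
    intro p _ e b
    by_cases hp : p
    · simpa [hp] using h e b
    · simp [hp]
  have hsum : ∀ p : E → Bool → Prop,
      (∑ e, ∑ b, if p e b then ∫ τ in s, r τ e b else 0) =
        ∫ τ in s, ∑ e, ∑ b, if p e b then r τ e b else 0 := by
    intro p
    rw [integral_finsetSum _ fun e _ => integrable_finsetSum _ fun b _ => hite (p e b) e b]
    refine Finset.sum_congr rfl fun e _ => ?_
    rw [integral_finsetSum _ fun b _ => hite (p e b) e b]
    refine Finset.sum_congr rfl fun b _ => ?_
    by_cases hp : p e b <;> simp [hp]
  have hint : ∀ p : E → Bool → Prop,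
      Integrable (fun τ => ∑ e, ∑ b, if p e b then r τ e b else 0) (volume.restrict s) :=
    fun p => integrable_finsetSum _ fun e _ => integrable_finsetSum _ fun b _ => hite (p e b) e b
  unfold Network.netOut
  rw [integral_sub (hint fun e b => G.tail e b = u) (hint fun e b => G.head e b = u)]
  exact congrArg₂ _ (hsum fun e b => G.tail e b = u) (hsum fun e b => G.head e b = u)

theorem Network.netOut_const_mul (G : Network V E) (c : ℝ) (x : E → Bool → ℝ) (u : V) :
    G.netOut (fun e b => c * x e b) u = c * G.netOut x u := by
  classical
  simp only [Network.netOut, mul_sub, Finset.mul_sum, mul_ite, mul_zero]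

variable {G : Network V E} {req : ℕ → Request V} {S : Set ℕ}

namespace Schedule

theorem rate_nonneg (σ : Schedule G req S) {i : ℕ} (hi : i ∈ S) (τ : ℝ) (e : E) (b : Bool) :
    0 ≤ σ.rate i τ e b :=
  ((σ.multiflow {i} (by simpa using hi) τ).flow i (by simp)).nonneg e b

theorem rate_le_cap (σ : Schedule G req S) {i : ℕ} (hi : i ∈ S) (τ : ℝ) (e : E) (b : Bool) :
    σ.rate i τ e b ≤ G.cap e := by
  have h := (σ.multiflow {i} (by simpa using hi) τ).capacity e
  have ht := σ.rate_nonneg hi τ e true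
  have hf := σ.rate_nonneg hi τ e false
  simp only [Finset.sum_singleton] at h
  cases b <;> linarith

theorem integrableOn_rate (σ : Schedule G req S) {i : ℕ} (hi : i ∈ S) (a c : ℝ) (e : E)
    (b : Bool) : IntegrableOn (fun τ => σ.rate i τ e b) (Set.Icc a c) := by
  refine Measure.integrableOn_of_bounded (M := G.cap e) (by simp)
    (σ.measurable_rate i hi e b).aestronglyMeasurable (ae_of_all _ fun τ => ?_)
  rw [Real.norm_of_nonneg (σ.rate_nonneg hi τ e b)]
  exact σ.rate_le_cap hi τ e b

/-- A whole file is transmitted in every time interval containing the lifetime of its request. -/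
theorem integral_netOut_eq_size (σ : Schedule G req S) {i : ℕ} (hi : i ∈ S) {a c : ℝ}
    (ha : a ≤ (req i).arrival) (hc : σ.completion i ≤ c) :
    ∫ τ in Set.Icc a c, G.netOut (σ.rate i τ) (req i).source = (req i).size := by
  rw [← σ.transmitted i hi, intervalIntegral.integral_of_le (σ.arrival_le_completion i hi),
    ← integral_Icc_eq_integral_Ioc]
  refine setIntegral_eq_of_subset_of_forall_sdiff_eq_zero measurableSet_Icc
    (Set.Icc_subset_Icc ha hc) fun τ hτ => ?_
  simp [Network.netOut, σ.rate_eq_zero i hi τ hτ.2]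

/-- A file of positive size cannot be sent in zero time. This makes `W`, and the times `T` by which
rates are divided, positive. -/
theorem arrival_lt_completion (σ : Schedule G req S) {i : ℕ} (hi : i ∈ S) :
    (req i).arrival < σ.completion i := by
  refine lt_of_le_of_ne (σ.arrival_le_completion i hi) fun h => ?_
  have ht := σ.transmitted i hi
  rw [← h, intervalIntegral.integral_same] at ht
  exact (req i).size_pos.ne ht

/-- Averaging an off-line schedule over the interval `[a, c]`: if all the requests in `L` are
served within `[a, c]`, then they are feasible in the augmented network in any time `T` with
`c - a ≤ (1 + ε) * T`. -/
theorem multicomm_augment (σ : Schedule G req S) {ε : ℝ} (hε : 0 < ε) {L : Finset ℕ}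
    (hL : (L : Set ℕ) ⊆ S) {a c T : ℝ} (hac : a ≤ c) (ha : ∀ i ∈ L, a ≤ (req i).arrival)
    (hc : ∀ i ∈ L, σ.completion i ≤ c) (hT : 0 < T) (hacT : c - a ≤ (1 + ε) * T) :
    (G.augment ε hε).Multicomm (fun i => (req i).toJob) L T := by
  have hnet : ∀ i ∈ L, ∀ u,
      G.netOut (fun e b => T⁻¹ * ∫ τ in Set.Icc a c, σ.rate i τ e b) u =
        T⁻¹ * ∫ τ in Set.Icc a c, G.netOut (σ.rate i τ) u := by
    intro i hi u
    rw [G.netOut_const_mul, G.netOut_integral _ _ (σ.integrableOn_rate (hL hi) a c)]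
  have hval : ∀ i ∈ L,
      G.netOut (fun e b => T⁻¹ * ∫ τ in Set.Icc a c, σ.rate i τ e b) (req i).source =
        T⁻¹ * (req i).size := fun i hi => by
    rw [hnet i hi, σ.integral_netOut_eq_size (hL hi) (ha i hi) (hc i hi)]
  have hflow : ∀ i ∈ L, ∀ τ, G.IsFlow (req i).source (req i).dest (σ.rate i τ) :=
    fun i hi τ => (σ.multiflow L hL τ).flow i hi
  -- The total amount sent is divided by `T` instead of `c - a`; this scales the average rates by
  -- `(c - a) / T ≤ 1 + ε`, which the augmented capacities absorb.
  refine ⟨hT.le, fun i e b => T⁻¹ * ∫ τ in Set.Icc a c, σ.rate i τ e b, ⟨fun i hi => ?_, ?_⟩, ?_⟩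
  · refine ⟨fun e b => ?_, fun e he => ?_, fun u hs hd => ?_, ?_⟩
    · exact mul_nonneg (inv_nonneg.2 hT.le) (integral_nonneg fun τ => (hflow i hi τ).nonneg e b)
    · have h0 : ∀ τ, σ.rate i τ e false = 0 := fun τ => (hflow i hi τ).direction e he
      simp [h0]
    · have h0 : ∀ τ, G.netOut (σ.rate i τ) u = 0 := fun τ => (hflow i hi τ).conservation u hs hd
      refine (hnet i hi u).trans ?_
      simp [h0]
    · exact (mul_nonneg (inv_nonneg.2 hT.le) (req i).size_pos.le).trans_eq (hval i hi).symm
  · intro e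
    have hint : ∀ i ∈ L, Integrable (fun τ => σ.rate i τ e true + σ.rate i τ e false)
        (volume.restrict (Set.Icc a c)) := fun i hi =>
      (σ.integrableOn_rate (hL hi) a c e true).add (σ.integrableOn_rate (hL hi) a c e false)
    have hsum : ∑ i ∈ L, (T⁻¹ * (∫ τ in Set.Icc a c, σ.rate i τ e true) +
          T⁻¹ * ∫ τ in Set.Icc a c, σ.rate i τ e false) =
        T⁻¹ * ∫ τ in Set.Icc a c, ∑ i ∈ L, (σ.rate i τ e true + σ.rate i τ e false) := by
      rw [integral_finsetSum _ hint, Finset.mul_sum]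
      refine Finset.sum_congr rfl fun i hi => ?_
      rw [integral_add (σ.integrableOn_rate (hL hi) a c e true)
        (σ.integrableOn_rate (hL hi) a c e false), mul_add]
    have hle : ∫ τ in Set.Icc a c, ∑ i ∈ L, (σ.rate i τ e true + σ.rate i τ e false) ≤
        (c - a) * G.cap e := by
      calc _ ≤ ∫ _ in Set.Icc a c, G.cap e :=
            integral_mono (integrable_finsetSum _ hint) (integrable_const _)
              fun τ => (σ.multiflow L hL τ).capacity e
        _ = (c - a) * G.cap e := by simp [hac]
    change _ ≤ (1 + ε) * G.cap e
    rw [hsum, inv_mul_le_iff₀ hT]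
    calc _ ≤ (c - a) * G.cap e := hle
      _ ≤ (1 + ε) * T * G.cap e := mul_le_mul_of_nonneg_right hacT (G.cap_nonneg e)
      _ = T * ((1 + ε) * G.cap e) := by ring
  · intro i hi
    refine (congrArg (· * T) (hval i hi)).trans ?_
    simp only
    field_simp

end Schedule

end Averaging

/-! ### The list of slots and its invariant. -/

namespace BatchLim

theorem tryAssign_eq_none {P : Slot → Prop} [DecidablePred P] {i : ℕ} {l : List Slot}
    (h : tryAssign P i l = none) : ∀ s ∈ l, ¬ P s := by
  induction l with
  | nil => simp
  | cons s l ih =>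
    by_cases hs : P s
    · simp [tryAssign, hs] at h
    · simp only [tryAssign, hs, if_false, Option.map_eq_none_iff] at h
      simpa [hs] using ih h

theorem tryAssign_eq_some {P : Slot → Prop} [DecidablePred P] {i : ℕ} {l : List Slot}
    {r : List Slot × ℝ} (h : tryAssign P i l = some r) :
    ∃ s ∈ l, P s ∧ r.2 = s.finish ∧
      ∀ s' ∈ r.1, s' ∈ l ∨ s' = { s with jobs := insert i s.jobs } := by
  induction l generalizing r with
  | nil => simp [tryAssign] at h
  | cons s l ih =>
    by_cases hs : P s
    · simp only [tryAssign, hs, if_true, Option.some.injEq] at h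
      subst h
      refine ⟨s, by simp, hs, rfl, fun s' hs' => ?_⟩
      rcases List.mem_cons.1 hs' with rfl | hs'
      · exact Or.inr rfl
      · exact Or.inl (List.mem_cons_of_mem _ hs')
    · simp only [tryAssign, hs, if_false, Option.map_eq_some_iff] at h
      obtain ⟨r, hr, rfl⟩ := h
      obtain ⟨s₀, hs₀, hP, hfin, hmem⟩ := ih hr
      refine ⟨s₀, List.mem_cons_of_mem _ hs₀, hP, hfin, fun s' hs' => ?_⟩
      rcases List.mem_cons.1 hs' with rfl | hs'
      · exact Or.inl (by simp)
      · exact (hmem s' hs').imp_left (List.mem_cons_of_mem _)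

variable {V E : Type*} [Fintype E]

/-- The properties of a slot created for request `j`, after the first `n` requests have been
handled: its start is delayed by at most its length and by at most `B`, and its length is at
most `B`. -/
structure SlotBound (req : ℕ → Request V) (B : ℝ) (n : ℕ) (s : Slot) (j : ℕ) : Prop where
  creator_lt : j < n
  -- The creator has the least number, hence the earliest arrival, among the jobs of its slot.
  jobs_mem : ∀ k ∈ s.jobs, j ≤ k ∧ k < n
  delay_le_length : s.start - (req j).arrival ≤ s.finish - s.start
  delay_le : s.start - (req j).arrival ≤ B
  length_le : s.finish - s.start ≤ B

theorem SlotBound.succ {req : ℕ → Request V} {B : ℝ} {n j : ℕ} {s : Slot}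
    (h : SlotBound req B n s j) : SlotBound req B (n + 1) s j :=
  { h with
    creator_lt := h.creator_lt.trans n.lt_succ_self
    jobs_mem := fun k hk => ⟨(h.jobs_mem k hk).1, (h.jobs_mem k hk).2.trans n.lt_succ_self⟩ }

/-- Only request numbers and slot times enter the invariant; the times do not change, and `n` comes
after the creator. -/
theorem SlotBound.insert {req : ℕ → Request V} {B : ℝ} {n j : ℕ} {s : Slot}
    (h : SlotBound req B n s j) :
    SlotBound req B (n + 1) { s with jobs := insert n s.jobs } j :=
  { h.succ with
    jobs_mem := fun k hk => by
      rcases Finset.mem_insert.1 hk with rfl | hk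
      · exact ⟨h.creator_lt.le, k.lt_succ_self⟩
      · exact h.succ.jobs_mem k hk }

/-- A bound for the delay of a new slot, from a bound for each slot that has not ended. -/
theorem nextStart_sub_le {t B : ℝ} {l : List Slot} (hB : 0 ≤ B)
    (h : ∀ s ∈ l, s.finish - t ≤ B) : nextStart t l - t ≤ B := by
  unfold nextStart
  split
  · simpa using hB
  · next s hs =>
    have := h s (List.mem_of_getLast? hs)
    rcases max_cases t s.finish with ⟨h, _⟩ | ⟨h, _⟩ <;> rw [h] <;> linarith

/-! ### Comparison of one step with an off-line schedule. -/

variable {G : Network V E} {req : ℕ → Request V} {S : Set ℕ}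

/-- In the augmented network the `maxflow` of a single request is at most the maximum waiting time
of any off-line schedule, divided by `1 + ε`. -/
theorem maxflow_augment_singleton_le (σ : Schedule G req S) {ε W : ℝ} (hε : 0 < ε) {n : ℕ}
    (hn : n ∈ S) (hW : σ.completion n - (req n).arrival ≤ W) :
    (G.augment ε hε).maxflow (fun k => (req k).toJob) {n} ≤ W / (1 + ε) := by
  have hlt := σ.arrival_lt_completion hn
  have hW0 : 0 < W := by linarith
  refine csInf_le ⟨0, fun T hT => hT.1⟩ ?_
  refine σ.multicomm_augment hε (by simpa using hn) (a := (req n).arrival)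
    (c := (req n).arrival + W) (by linarith) (by simp) ?_ (by positivity) ?_
  · simp only [Finset.mem_singleton, forall_eq]
    linarith
  · rw [mul_div_cancel₀ _ (by positivity)]
    linarith

/-- A slot into which a new request does not fit, although it has not begun, is short. -/
theorem length_le_of_not_fits (σ : Schedule G req S) {ε W B : ℝ} (hε : 0 < ε) (hW0 : 0 < W)
    (hW : ∀ k ∈ S, σ.completion k - (req k).arrival ≤ W) {n j : ℕ} {s : Slot}
    (hS : ∀ k ≤ n, k ∈ S) (hmono : ∀ i k : ℕ, i ≤ k → k ≤ n → (req i).arrival ≤ (req k).arrival)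
    (hs : SlotBound req B n s j) (hstart : (req n).arrival ≤ s.start)
    (hfit : ¬ Fits (G.augment ε hε) req n s) : s.finish - s.start ≤ W / ε := by
  by_contra! hlen
  have hmem : ∀ k ∈ insert n s.jobs, j ≤ k ∧ k ≤ n := fun k hk =>
    have h := hs.insert.jobs_mem k hk
    ⟨h.1, Nat.lt_succ_iff.1 h.2⟩
  have hjn := hmono j n hs.creator_lt.le le_rfl
  have hεlen := (div_lt_iff₀' hε).1 hlen
  refine hfit ⟨hstart, σ.multicomm_augment hε (fun k hk => hS k (hmem k hk).2)
    (a := (req j).arrival) (c := (req n).arrival + W) (by linarith)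
    (fun k hk => hmono j k (hmem k hk).1 (hmem k hk).2) (fun k hk => ?_)
    ((by positivity : 0 < W / ε).trans hlen) ?_⟩
  · have h₁ := hW k (hS k (hmem k hk).2)
    have h₂ := hmono k n (hmem k hk).2 le_rfl
    linarith
  -- The window has length `(a_n - a_j) + W ≤ (s.start - a_j) + W ≤ ℓ + W < (1 + ε) * ℓ`.
  · have := hs.delay_le_length
    linarith

/-- One step of `BatchLim` preserves the bounds on the slots and keeps the new waiting time within
twice the bound. -/
theorem step_bound (σ : Schedule G req S) {ε W : ℝ} (hε : 0 < ε)
    (hW : ∀ k ∈ S, σ.completion k - (req k).arrival ≤ W) {n : ℕ} {l : List Slot}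
    (hS : ∀ k ≤ n, k ∈ S) (hmono : ∀ i k : ℕ, i ≤ k → k ≤ n → (req i).arrival ≤ (req k).arrival)
    (hl : ∀ s ∈ l, ∃ j, SlotBound req (2 * (W / ε)) n s j) :
    (∀ s ∈ (step (G.augment ε hε) req n l).1, ∃ j, SlotBound req (2 * (W / ε)) (n + 1) s j) ∧
      (step (G.augment ε hε) req n l).2 - (req n).arrival ≤ 2 * (2 * (W / ε)) := by
  classical
  have hW0 : 0 < W := by
    have h₁ := σ.arrival_lt_completion (hS n le_rfl)
    have h₂ := hW n (hS n le_rfl)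
    linarith
  have hWε : 0 < W / ε := by positivity
  unfold step
  split
  · next r hr =>
    obtain ⟨s, hs, -, hfin, hmem⟩ := tryAssign_eq_some hr
    obtain ⟨j, hj⟩ := hl s hs
    refine ⟨fun s' hs' => ?_, ?_⟩
    · rcases hmem s' hs' with h | rfl
      · exact (hl s' h).imp fun _ => SlotBound.succ
      · exact ⟨j, hj.insert⟩
    · have h₁ := hmono j n hj.creator_lt.le le_rfl
      have h₂ := hj.delay_le
      have h₃ := hj.length_le
      rw [hfin]
      linarith
  · next hnone =>
    have hfit := tryAssign_eq_none hnone
    have hM : (G.augment ε hε).maxflow (fun k => (req k).toJob) {n} ≤ 2 * (W / ε) := by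
      have h₁ := maxflow_augment_singleton_le σ hε (hS n le_rfl) (hW n (hS n le_rfl))
      have h₂ : W / (1 + ε) ≤ W / ε := div_le_div_of_nonneg_left hW0.le hε (by linarith)
      linarith
    have hdelay : nextStart (req n).arrival l - (req n).arrival ≤ 2 * (W / ε) := by
      refine nextStart_sub_le (by positivity) fun s hs => ?_
      obtain ⟨j, hj⟩ := hl s hs
      have hjn := hmono j n hj.creator_lt.le le_rfl
      -- A slot not yet begun has `ℓ ≤ W / ε` and ends within `2 * ℓ` of `a_j ≤ a_n`. A slot already
      -- begun has less than its length left, so the bound `2 * (W / ε)` reproduces itself.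
      rcases le_or_gt (req n).arrival s.start with h | h
      · have h₁ := length_le_of_not_fits σ hε hW0 hW hS hmono hj h (hfit s hs)
        have h₂ := hj.delay_le_length
        linarith
      · have := hj.length_le
        linarith
    dsimp only
    set start := nextStart (req n).arrival l
    set M := (G.augment ε hε).maxflow (fun k => (req k).toJob) {n}
    have hfin : (if M > start - (req n).arrival then start + M
        else start + (start - (req n).arrival)) = start + max (start - (req n).arrival) M := by
      split_ifs with h
      · rw [max_eq_right h.le]
      · rw [max_eq_left (not_lt.1 h)]
    rw [hfin]
    have hmax : max (start - (req n).arrival) M ≤ 2 * (W / ε) := max_le hdelay hM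
    refine ⟨fun s hs => ?_, by linarith⟩
    rcases List.mem_append.1 hs with hs | hs
    · exact (hl s hs).imp fun _ => SlotBound.succ
    · rw [List.mem_singleton] at hs
      subst hs
      refine ⟨n, n.lt_succ_self, fun k hk => ?_, ?_, hdelay, ?_⟩
      · rw [Finset.mem_singleton.1 hk]
        exact ⟨le_rfl, n.lt_succ_self⟩
      -- The length is a maximum that includes the delay.
      · simp
      · simpa using hmax

theorem slots_bound (σ : Schedule G req S) {ε W : ℝ} (hε : 0 < ε)
    (hW : ∀ k ∈ S, σ.completion k - (req k).arrival ≤ W) {n : ℕ}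
    (hS : ∀ k < n, k ∈ S) (hmono : ∀ i k : ℕ, i ≤ k → k < n → (req i).arrival ≤ (req k).arrival) :
    ∀ s ∈ slots (G.augment ε hε) req n, ∃ j, SlotBound req (2 * (W / ε)) n s j := by
  induction n with
  | zero => simp [slots]
  | succ n ih =>
    exact (step_bound σ hε hW (fun k hk => hS k (by omega))
      (fun i k hik hk => hmono i k hik (by omega))
      (ih (fun k hk => hS k (by omega)) fun i k hik hk => hmono i k hik (by omega))).1

/-- The waiting times of `BatchLim` in the augmented network, compared with those of an off-line
schedule for an initial segment of the requests. -/
theorem completion_sub_arrival_le (σ : Schedule G req S) {ε W : ℝ} (hε : 0 < ε)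
    (hW : ∀ k ∈ S, σ.completion k - (req k).arrival ≤ W) {n : ℕ} (hS : ∀ k ≤ n, k ∈ S)
    (hmono : ∀ i k : ℕ, i ≤ k → k ≤ n → (req i).arrival ≤ (req k).arrival) :
    completion (G.augment ε hε) req n - (req n).arrival ≤ 4 / ε * W := by
  have h := (step_bound σ hε hW hS hmono (slots_bound σ hε hW (fun k hk => hS k hk.le)
    fun i k hik hk => hmono i k hik hk.le)).2
  calc _ ≤ 2 * (2 * (W / ε)) := h
    _ = 4 / ε * W := by ring

end BatchLim

/-! ### Passage to the infimum over schedules. -/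

theorem mainTheorem2 {V E : Type*} [Fintype V] [Fintype E] (G : Network V E)
    (N : ℕ∞) (req : ℕ → Request V)
    (hreq : ∀ i j : ℕ, i ≤ j → (j : ℕ∞) < N → (req i).arrival ≤ (req j).arrival)
    (ε : ℝ) (hε : 0 < ε) (tstar : ℝ) :
    maxWait req (arrivedUpTo N req tstar) (BatchLim.completion (G.augment ε hε) req) ≤
      ENNReal.ofReal (4 / ε) * optMaxWait G req (arrivedUpTo N req tstar) := by
  have hc : 0 < 4 / ε := by positivity
  unfold optMaxWait
  rw [ENNReal.mul_iInf_of_ne (ENNReal.ofReal_pos.2 hc).ne' ENNReal.ofReal_ne_top]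
  refine le_iInf fun σ => ?_
  by_cases htop : maxWait req (arrivedUpTo N req tstar) σ.completion = ⊤
  · rw [htop, ENNReal.mul_top (ENNReal.ofReal_pos.2 hc).ne']
    exact le_top
  refine iSup₂_le fun n hn => ?_
  have hW : ∀ k ∈ arrivedUpTo N req tstar, σ.completion k - (req k).arrival ≤
      (maxWait req (arrivedUpTo N req tstar) σ.completion).toReal := fun k hk =>
    (ENNReal.ofReal_le_iff_le_toReal htop).1
      (le_iSup₂ (f := fun i _ => ENNReal.ofReal (σ.completion i - (req i).arrival)) k hk)
  -- Arrivals are ordered, so all requests handled up to `n` belong to the set that the schedule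
  -- serves.
  have hlt : ∀ k ≤ n, (k : ℕ∞) < N := fun k hk => (Nat.cast_le.2 hk).trans_lt hn.1
  have h := BatchLim.completion_sub_arrival_le σ hε hW
    (fun k hk => ⟨hlt k hk, (hreq k n hk hn.1).trans hn.2⟩)
    fun i k hik hk => hreq i k hik (hlt k hk)
  calc _ ≤ ENNReal.ofReal (4 / ε * _) := ENNReal.ofReal_le_ofReal h
    _ = _ := by rw [ENNReal.ofReal_mul hc.le, ENNReal.ofReal_toReal htop]
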